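/- Let $k_0>0$, let $\nu,\omega\in\mathbb R^3$ be unit vectors, and let $e_3=(0,0,1)$. For $v\in\mathbb R^3\setminus\{0\}$ put $$S_v=\{x\in\mathbb R^3 : \|x\|=k_0,\ \langle x,v\rangle>0\},$$ let $H_\nu x=x-2\langle x,\nu\rangle\nu$ be the reflection across the plane $\nu^\perp$, and for $\sigma\neq0$ let $\pi_\sigma x=x-\langle x,\sigma\rangle\sigma/\|\sigma\|^2$ be the orthogonal projection onto $\sigma^\perp$. Define $$\Sigma_1=\{\sigma\in S_\omega : H_\nu\sigma\notin S_\omega\},\qquad \Sigma_2=\{\sigma\in S_\omega : H_\nu\sigma\in S_\omega\},\qquad \mathcal Y_j=\{\eta-\sigma : \eta\in S_{e_3},\ \sigma\in\Sigma_j\}\quad(j=1,2).$$ Let $\chi\in(0,1)$, let $\Sigma_{2,\chi}=\{t\sigma : \sigma\in\Sigma_2,\ 1-\chi<t<1+\chi\}$ (an open subset of $\mathbb R^3$), and let $b\in C^2(\Sigma_{2,\chi};\mathbb C)$ be a function without zeros such that $b(t\sigma)=b(\sigma)$ for all $\sigma\in\Sigma_2$ and $t\in(1-\chi,1+\chi)$.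 Assume that the set $$\{\sigma\in\Sigma_2 : \nabla b(\sigma)\notin\mathbb C\,\pi_\sigma\nu\}$$ is dense in $\Sigma_2$, where $\nabla b(\sigma)\in\mathbb C^3$ is the vector of partial derivatives of $b$ at $\sigma$. Then every continuous function $g:\mathbb R^3\to\mathbb C$ which satisfies, for all $\eta\in S_{e_3}$, $$g(\eta-\sigma)=0\quad\text{for all }\sigma\in\Sigma_1,\qquad b(\sigma)\,g(\eta-\sigma)+g(\eta-H_\nu\sigma)=0\quad\text{for all }\sigma\in\Sigma_2,$$ fulfills $g(y)=0$ for all $y\in\mathcal Y_1\cup\mathcal Y_2$. -/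

import Mathlib

namespace ScanDiffraction

noncomputable section

/-- Three-dimensional Euclidean space. -/
abbrev E3 : Type := EuclideanSpace ℝ (Fin 3)

/-- The standard basis vectors of `ℝ³`, indexed by `0, 1, 2`. -/
def stdVec (i : Fin 3) : E3 := EuclideanSpace.single i (1 : ℝ)

/-- The open hemisphere `S_v` of radius `k₀` in the direction of `v`. -/
def hemisphere (k₀ : ℝ) (v : E3) : Set E3 :=
  {x | ‖x‖ = k₀ ∧ 0 < inner ℝ x v}

/-- The Householder reflection `H_v x = x - 2⟨x, v⟩v` (used for unit vectors `v`). -/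
def householder (v x : E3) : E3 := x - (2 * inner ℝ x v) • v

/-- `π_σ x = x - ⟨x, σ⟩ σ / ‖σ‖²`, the orthogonal projection onto `σ^⊥` (used for `σ ≠ 0`). -/
def projPerp (σ x : E3) : E3 := x - (inner ℝ x σ / ‖σ‖ ^ 2) • σ

/-- The directions in `S_ω` whose reflection leaves `S_ω`. -/
def Sigma1 (k₀ : ℝ) (ν ω : E3) : Set E3 :=
  {σ | σ ∈ hemisphere k₀ ω ∧ householder ν σ ∉ hemisphere k₀ ω}

/-- The directions in `S_ω` whose reflection remains in `S_ω`. -/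
def Sigma2 (k₀ : ℝ) (ν ω : E3) : Set E3 :=
  {σ | σ ∈ hemisphere k₀ ω ∧ householder ν σ ∈ hemisphere k₀ ω}

/-- The open radial neighbourhood `Σ_{2,χ} = {t σ | σ ∈ Σ₂, t ∈ (1 - χ, 1 + χ)}` of `Σ₂`. -/
def Sigma2Nhd (k₀ : ℝ) (ν ω : E3) (χ : ℝ) : Set E3 :=
  {x | ∃ σ ∈ Sigma2 k₀ ν ω, ∃ t ∈ Set.Ioo (1 - χ) (1 + χ), x = t • σ}

/-- `𝒴₁ = {η - σ | η ∈ S_{e₃}, σ ∈ Σ₁}`. -/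
def Y1 (k₀ : ℝ) (ν ω : E3) : Set E3 :=
  {y | ∃ η ∈ hemisphere k₀ (stdVec 2), ∃ σ ∈ Sigma1 k₀ ν ω, y = η - σ}

/-- `𝒴₂ = {η - σ | η ∈ S_{e₃}, σ ∈ Σ₂}`. -/
def Y2 (k₀ : ℝ) (ν ω : E3) : Set E3 :=
  {y | ∃ η ∈ hemisphere k₀ (stdVec 2), ∃ σ ∈ Sigma2 k₀ ν ω, y = η - σ}

/-- `g` solves the homogeneous system with coefficient function `b`. -/
def SolvesHomogeneous (k₀ : ℝ) (ν ω : E3) (b g : E3 → ℂ) : Prop :=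
  ∀ η ∈ hemisphere k₀ (stdVec 2),
    (∀ σ ∈ Sigma1 k₀ ν ω, g (η - σ) = 0) ∧
    (∀ σ ∈ Sigma2 k₀ ν ω, b σ * g (η - σ) + g (η - householder ν σ) = 0)

/-- The gradient `∇b(x) = (∂₁b(x), ∂₂b(x), ∂₃b(x)) ∈ ℂ³` of a complex-valued function of three
real variables. -/
def grad (b : E3 → ℂ) (x : E3) : Fin 3 → ℂ := fun i => fderiv ℝ b x (stdVec i)

/-- The complex line `ℂ v ⊆ ℂ³` spanned by a real vector `v`. -/
def complexLine (v : E3) : Set (Fin 3 → ℂ) :=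
  {w | ∃ c : ℂ, ∀ i, w i = c * ((v i : ℝ) : ℂ)}

end

end ScanDiffraction

/-!
On `𝒴₁` the claim is part of the system. On `𝒴₂`, suppose that `g(η - σ) ≠ 0` for some `η ∈ S_{e₃}` and
`σ ∈ Σ₂`. By continuity this persists for nearby pairs, and the reflection equation then
expresses `b` near `σ` as a quotient of values of `g`. It is shown that `∇b(σ) ∈ ℂ π_σ ν` for some such `σ` in the dense
set, a contradiction.

Write `s = ⟨σ, ν⟩`, `t = ⟨η, ν⟩`, and let `d` be the component of `η - σ` orthogonal to `ν`. Then
`η - σ = (t - s) ν + d` and `η - H_ν σ = (t + s) ν + d`. For fixed `d` the pairs `(σ, η)` on the sphere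
form a surface with local coordinates `(s, t)` (`surf`), on which the equation reads
`b(σ(s, t)) G(t - s) = -G(t + s)` with `G p = g(p ν + d)` (`surf_line_eq`). So `log b` satisfies the
wave equation in `(s, t)`; as the parallelogram identity
`f(s + τ, t) f(s - τ, t) = f(s, t + τ) f(s, t - τ)` for `f = b ∘ σ` shows, this uses that `b` is `C²` but
no regularity of `g` (`wave_identity`).

Now `σ` is kept fixed and `η`, hence `d`, varies. In suitable coordinates `(A, B)` for `d`, obtained by
an inversion, the wave equation becomes polynomial after multiplication by `B³` (`clearedWave`). It
can be continued analytically in `η` along a great circle to the pole `η = k₀ ν`, where `A = -1` and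
`B = 0`. There the coordinates `(s, t)` degenerate and the only surviving term is the derivative of
`b` in the direction orthogonal to `ν` and `σ`, which therefore vanishes
(`fderiv_eq_zero_of_reflectionEq`). Since `b` is radially constant, its derivative along `σ` vanishes
too, and the gradient is a multiple of `π_σ ν` (`grad_mem_complexLine`).
-/

open Filter Topology

namespace ScanDiffraction

/-! ### Second derivatives along curves -/

theorem hasDerivAt_comp_neg_of_hasDerivAt {K : ℝ → ℂ} {K' : ℂ} {τ : ℝ}
    (h : HasDerivAt K K' (-τ)) : HasDerivAt (fun τ => K (-τ)) (-K') τ := by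
  have := h.scomp τ (hasDerivAt_neg τ)
  rw [neg_one_smul] at this
  exact this

/-- If the symmetric products `F τ F(-τ)` and `G τ G(-τ)` agree near `0`, then so do the expressions
`F F'' - F'²` and `G G'' - G'²` at `0`: each is half the second derivative of its product. -/
theorem mul_second_deriv_sub_sq_deriv_eq {F G F' G' : ℝ → ℂ} {F'' G'' : ℂ}
    (hF : ∀ᶠ τ in 𝓝 0, HasDerivAt F (F' τ) τ) (hF' : HasDerivAt F' F'' 0)
    (hG : ∀ᶠ τ in 𝓝 0, HasDerivAt G (G' τ) τ) (hG' : HasDerivAt G' G'' 0)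
    (h : ∀ᶠ τ in 𝓝 0, F τ * F (-τ) = G τ * G (-τ)) :
    F 0 * F'' - F' 0 ^ 2 = G 0 * G'' - G' 0 ^ 2 := by
  have key : ∀ {K K' : ℝ → ℂ} {K'' : ℂ}, (∀ᶠ τ in 𝓝 0, HasDerivAt K (K' τ) τ) →
      HasDerivAt K' K'' 0 →
      deriv (deriv fun τ => K τ * K (-τ)) 0 = 2 * (K 0 * K'' - K' 0 ^ 2) := by
    intro K K' K'' hK hK'
    have hneg : Tendsto (fun τ : ℝ => -τ) (𝓝 0) (𝓝 0) := by
      simpa using (continuous_neg (G := ℝ)).tendsto 0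
    have h1 : (deriv fun τ => K τ * K (-τ)) =ᶠ[𝓝 0]
        fun τ => K' τ * K (-τ) + K τ * (-K' (-τ)) := by
      filter_upwards [hK, hneg.eventually hK] with τ h1 h2
      exact (h1.mul (hasDerivAt_comp_neg_of_hasDerivAt h2)).deriv
    rw [h1.deriv_eq]
    have h0 : HasDerivAt K (K' (-0)) (-0) := by simpa using hK.self_of_nhds
    have h0' : HasDerivAt K' K'' (-0) := by simpa using hK'
    have e1 : HasDerivAt (fun τ : ℝ => K (-τ)) (-K' 0) 0 := by
      exact (hasDerivAt_comp_neg_of_hasDerivAt h0).congr_deriv (by simp)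
    have e2 : HasDerivAt (fun τ : ℝ => K' (-τ)) (-K'') 0 := by
      exact hasDerivAt_comp_neg_of_hasDerivAt h0'
    have := ((hK'.mul e1).add (hK.self_of_nhds.mul e2.neg)).deriv
    simp only [Pi.neg_apply, neg_zero, neg_neg] at this
    refine Eq.trans ?_ (this.trans ?_)
    · rfl
    · ring
  have e := key hF hF'
  have h2 : (fun τ => F τ * F (-τ)) =ᶠ[𝓝 0] fun τ => G τ * G (-τ) := h
  rw [h2.deriv.deriv_eq, key hG hG'] at e
  exact (mul_left_cancel₀ two_ne_zero e).symm

/-- First derivatives near `0`, and the second derivative at `0`, of a `C²` function along a curve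
`c` with velocity `c'` and acceleration `c''`. -/
theorem hasDerivAt_comp_curve {E : Type*} [NormedAddCommGroup E] [NormedSpace ℝ E] {b : E → ℂ}
    {c c' : ℝ → E} {c'' : E} (hb : ContDiffAt ℝ 2 b (c 0))
    (hc : ∀ᶠ τ in 𝓝 0, HasDerivAt c (c' τ) τ) (hc' : HasDerivAt c' c'' 0) :
    (∀ᶠ τ in 𝓝 0, HasDerivAt (fun τ => b (c τ)) (fderiv ℝ b (c τ) (c' τ)) τ) ∧
    HasDerivAt (fun τ => fderiv ℝ b (c τ) (c' τ))
      (fderiv ℝ (fderiv ℝ b) (c 0) (c' 0) (c' 0) + fderiv ℝ b (c 0) c'') 0 := by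
  have hcont : ContinuousAt c 0 := hc.self_of_nhds.continuousAt
  constructor
  · have h1 : ∀ᶠ x in 𝓝 (c 0), ContDiffAt ℝ 2 b x := hb.eventually (by simp)
    filter_upwards [hc, hcont.eventually h1] with τ h2 h3
    exact (h3.differentiableAt (by simp)).hasFDerivAt.comp_hasDerivAt τ h2
  · have h1 : ContDiffAt ℝ 1 (fderiv ℝ b) (c 0) := hb.fderiv_right (by norm_num)
    have h2 := (h1.differentiableAt (by simp)).hasFDerivAt.comp_hasDerivAt 0 hc.self_of_nhds
    exact h2.clm_apply hc'

theorem hasDerivAt_sqrt_comp {P P' : ℝ → ℝ} {p B : ℝ} (hB : 0 < B) (h0 : P 0 = B ^ 2)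
    (hP : ∀ τ, HasDerivAt P (P' τ) τ) (hP' : HasDerivAt P' p 0) :
    (∀ᶠ τ in 𝓝 0, HasDerivAt (fun τ => √(P τ)) (P' τ / (2 * √(P τ))) τ) ∧
    HasDerivAt (fun τ => P' τ / (2 * √(P τ))) ((p / 2 - (P' 0 / (2 * B)) ^ 2) / B) 0 := by
  have hs : √(P 0) = B := by rw [h0, Real.sqrt_sq hB.le]
  have h1 : ∀ τ, P τ ≠ 0 → HasDerivAt (fun τ => √(P τ)) (P' τ / (2 * √(P τ))) τ :=
    fun τ h => (hP τ).sqrt h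
  have hP0 : P 0 ≠ 0 := by rw [h0]; positivity
  refine ⟨((hP 0).continuousAt.eventually_ne hP0).mono h1, ?_⟩
  have h2 := hP'.div ((h1 0 hP0).const_mul 2) (by rw [hs]; positivity)
  rw [hs] at h2
  refine h2.congr_deriv ?_
  field_simp

/-! ### Pairs of points on the sphere with a prescribed difference orthogonal to `ν` -/

/-- The coordinate `ξ` along `d` of the point `σ(s, t)` with `‖σ‖ = k`, `⟨σ, ν⟩ = s`,
`‖σ + (t - s) ν + d‖ = k`, where `D = ‖d‖²` and `d ⊥ ν`. It is used for `D ≠ 0`. -/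
noncomputable def xiFun (D s t : ℝ) : ℝ := (s ^ 2 - t ^ 2 - D) / (2 * D)

/-- The square of the coordinate of `σ(s, t)` along the quarter turn `d'` of `d` in `ν^⊥`. -/
noncomputable def radFun (k D s t : ℝ) : ℝ := (k ^ 2 - s ^ 2) / D - xiFun D s t ^ 2

/-- The point `σ(s, t)` of the sphere of radius `k` in the orthogonal frame `(ν, d, d')`, where `d'`
is a quarter turn of `d` and `‖d‖² = D`: its `ν`-coordinate is `s`, and `σ(s, t) + (t - s) ν + d`
is on the sphere as well, with `ν`-coordinate `t`. Of the two such points it is the one with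
nonnegative `d'`-coordinate. It has these properties only where `radFun k D s t` is nonnegative. -/
noncomputable def surf (ν d d' : E3) (k D s t : ℝ) : E3 :=
  s • ν + xiFun D s t • d + √(radFun k D s t) • d'

/-- Velocity and acceleration of `surf` along the line `τ ↦ (s + a τ, t + a' τ)`, at a point where its
`d`-coordinate is `A` and its `d'`-coordinate is `B > 0`. -/
theorem hasDerivAt_surf_line {ν d d' : E3} {k D s t A B : ℝ} (hD : 0 < D) (hB : 0 < B)
    (hA : xiFun D s t = A) (hr : radFun k D s t = B ^ 2) (a a' : ℝ) :
    ∃ c' : ℝ → E3,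
      (∀ᶠ τ in 𝓝 0, HasDerivAt (fun τ => surf ν d d' k D (s + a * τ) (t + a' * τ)) (c' τ) τ) ∧
      c' 0 = a • ν + ((a * s - a' * t) / D) • d
        + ((-a * s / D - A * ((a * s - a' * t) / D)) / B) • d' ∧
      HasDerivAt c' (((a ^ 2 - a' ^ 2) / D) • d +
        ((-a ^ 2 / D - ((a * s - a' * t) / D) ^ 2 - A * ((a ^ 2 - a' ^ 2) / D)
          - ((-a * s / D - A * ((a * s - a' * t) / D)) / B) ^ 2) / B) • d') 0 := by
  have hs : ∀ τ, HasDerivAt (fun τ => s + a * τ) a τ := fun τ => by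
    simpa using ((hasDerivAt_id τ).const_mul a).const_add s
  have ht : ∀ τ, HasDerivAt (fun τ => t + a' * τ) a' τ := fun τ => by
    simpa using ((hasDerivAt_id τ).const_mul a').const_add t
  have hx : ∀ τ, HasDerivAt (fun τ => xiFun D (s + a * τ) (t + a' * τ))
      ((a * (s + a * τ) - a' * (t + a' * τ)) / D) τ := fun τ => by
    have := ((((hs τ).pow 2).sub ((ht τ).pow 2)).sub_const D).div_const (2 * D)
    refine this.congr_deriv ?_
    field_simp
    simp
  have hx' : HasDerivAt (fun τ => (a * (s + a * τ) - a' * (t + a' * τ)) / D)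
      ((a ^ 2 - a' ^ 2) / D) 0 := by
    refine ((((hs 0).const_mul a).sub ((ht 0).const_mul a')).div_const D).congr_deriv ?_
    ring
  have hP : ∀ τ, HasDerivAt (fun τ => radFun k D (s + a * τ) (t + a' * τ))
      (-2 * a * (s + a * τ) / D - 2 * xiFun D (s + a * τ) (t + a' * τ) *
        ((a * (s + a * τ) - a' * (t + a' * τ)) / D)) τ := fun τ => by
    refine (((((hs τ).pow 2).const_sub (k ^ 2)).div_const D).sub ((hx τ).pow 2)).congr_deriv ?_
    simp
    ring
  have hP' := (((hs 0).const_mul (-2 * a)).div_const D).sub (((hx 0).const_mul 2).mul hx')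
  obtain ⟨h1, h2⟩ := hasDerivAt_sqrt_comp (P := fun τ => radFun k D (s + a * τ) (t + a' * τ)) hB
    (by simpa using hr) hP hP'
  refine ⟨fun τ => a • ν + ((a * (s + a * τ) - a' * (t + a' * τ)) / D) • d +
    ((-2 * a * (s + a * τ) / D - 2 * xiFun D (s + a * τ) (t + a' * τ) *
        ((a * (s + a * τ) - a' * (t + a' * τ)) / D)) /
      (2 * √(radFun k D (s + a * τ) (t + a' * τ)))) • d', ?_, ?_,
    ((hx'.smul_const d).const_add (a • ν)).add (h2.smul_const d') |>.congr_deriv ?_⟩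
  · filter_upwards [h1] with τ h1
    exact (((hs τ).smul_const ν).add ((hx τ).smul_const d)).add (h1.smul_const d')
  · simp only [mul_zero, add_zero, hA, hr, Real.sqrt_sq hB.le]
    congr 2
    field_simp
  · simp only [mul_zero, add_zero, hA]
    congr 2
    field_simp
    ring

/-! ### The wave equation for the coefficient -/

section Frame
variable {ν e f : E3}

theorem inner_frame (h : Orthonormal ℝ ![ν, e, f]) (a b c a' b' c' : ℝ) :
    inner ℝ (a • ν + b • e + c • f) (a' • ν + b' • e + c' • f) = a * a' + b * b' + c * c' := by
  have := h.inner_sum ![a, b, c] ![a', b', c'] Finset.univ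
  simpa [Fin.sum_univ_three] using this

theorem norm_sq_frame (h : Orthonormal ℝ ![ν, e, f]) (a b c : ℝ) :
    ‖a • ν + b • e + c • f‖ ^ 2 = a ^ 2 + b ^ 2 + c ^ 2 := by
  rw [← real_inner_self_eq_norm_sq, inner_frame h]
  ring

theorem householder_frame (h : Orthonormal ℝ ![ν, e, f]) (a b c : ℝ) :
    householder ν (a • ν + b • e + c • f) = (-a) • ν + b • e + c • f := by
  have := inner_frame h a b c 1 0 0
  simp only [one_smul, zero_smul, add_zero, mul_one, mul_zero] at this
  rw [householder, this]
  module

end Frame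

/-- The reflection equation `b(σ') g(η' - σ') + g(η' - H_ν σ') = 0` for all pairs `(σ', η')` near
`(σ, η)` of points of the sphere of radius `k`. -/
def ReflectionEqNear (k : ℝ) (ν : E3) (b g : E3 → ℂ) (σ η : E3) : Prop :=
  ∀ᶠ p : E3 × E3 in 𝓝 (σ, η), ‖p.1‖ = k → ‖p.2‖ = k →
    b p.1 * g (p.2 - p.1) + g (p.2 - householder ν p.1) = 0

/-- In the coordinates `(s, t)` the reflection equation involves `g` on a single line parallel to `ν`
only: with `G p = g(p ν + d)` it reads `b(σ(s, t)) G(t - s) = -G(t + s)`. Here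
`d = κ (A e - B f)` and `d' = κ (B e + A f)`. -/
theorem surf_line_eq {ν e f : E3} (h : Orthonormal ℝ ![ν, e, f]) {b g : E3 → ℂ}
    {k ρ κ D s t A B : ℝ} (hk : 0 < k) (hD : 0 < D) (hB : 0 < B)
    (hκ : κ ^ 2 * (A ^ 2 + B ^ 2) = D)
    (hA : xiFun D s t = A) (hr : radFun k D s t = B ^ 2)
    (hσ : s • ν + ρ • e = surf ν ((κ * A) • e + (-(κ * B)) • f)
      ((κ * B) • e + (κ * A) • f) k D s t)
    (heq : ReflectionEqNear k ν b g (s • ν + ρ • e)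
      (t • ν + (ρ + κ * A) • e + (-(κ * B)) • f)) (a a' : ℝ) :
    ∀ᶠ τ in 𝓝 (0 : ℝ),
      b (surf ν ((κ * A) • e + (-(κ * B)) • f) ((κ * B) • e + (κ * A) • f) k D
          (s + a * τ) (t + a' * τ)) *
        g ((t - s + (a' - a) * τ) • ν + ((κ * A) • e + (-(κ * B)) • f))
      = -g ((t + s + (a' + a) * τ) • ν + ((κ * A) • e + (-(κ * B)) • f)) := by
  obtain ⟨c', hc', -, -⟩ := hasDerivAt_surf_line (ν := ν) (d := (κ * A) • e + (-(κ * B)) • f)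
    (d' := (κ * B) • e + (κ * A) • f) hD hB hA hr a a'
  set c := fun τ => surf ν ((κ * A) • e + (-(κ * B)) • f) ((κ * B) • e + (κ * A) • f) k D
          (s + a * τ) (t + a' * τ) with hc
  have hcont : ContinuousAt c 0 := hc'.self_of_nhds.continuousAt
  have hc0 : c 0 = s • ν + ρ • e := by simp [hc, hσ]
  have hpair : ContinuousAt (fun τ => (c τ, c τ + ((t - s + (a' - a) * τ) • ν +
      ((κ * A) • e + (-(κ * B)) • f)))) 0 := by fun_prop
  have hrad : ∀ᶠ τ in 𝓝 (0 : ℝ), 0 < radFun k D (s + a * τ) (t + a' * τ) := by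
    have : ContinuousAt (fun τ => radFun k D (s + a * τ) (t + a' * τ)) 0 := by
      unfold radFun xiFun; fun_prop
    refine this.eventually_const_lt ?_
    simp only [mul_zero, add_zero, hr]; positivity
  have hp0 : (fun τ => (c τ, c τ + ((t - s + (a' - a) * τ) • ν +
      ((κ * A) • e + (-(κ * B)) • f)))) 0 =
      (s • ν + ρ • e, t • ν + (ρ + κ * A) • e + (-(κ * B)) • f) := by
    simp only [hc0, Prod.mk.injEq, true_and]
    module
  have h1 := hpair.tendsto
  beta_reduce at hp0
  rw [hp0] at h1
  filter_upwards [h1.eventually heq, hrad] with τ h2 h3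
  set s' := s + a * τ
  set t' := t + a' * τ
  set ξ := xiFun D s' t' with hξ
  set r := √(radFun k D s' t') with hr'
  have hr2 : r ^ 2 = (k ^ 2 - s' ^ 2) / D - ξ ^ 2 := Real.sq_sqrt h3.le
  have hξ2 : 2 * D * ξ = s' ^ 2 - t' ^ 2 - D := by
    rw [hξ, xiFun]; field_simp
  have hr3 : D * r ^ 2 = k ^ 2 - s' ^ 2 - D * ξ ^ 2 := by
    rw [hr2]; field_simp
  have hcτ : c τ = s' • ν + (κ * (ξ * A + r * B)) • e + (κ * (r * A - ξ * B)) • f := by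
    simp only [hc, surf]
    module
  have hητ : c τ + ((t - s + (a' - a) * τ) • ν + ((κ * A) • e + (-(κ * B)) • f)) =
      t' • ν + (κ * ((ξ + 1) * A + r * B)) • e + (κ * (r * A - (ξ + 1) * B)) • f := by
    rw [hcτ]; module
  -- Both points of the pair stay on the sphere, so the reflection equation applies to them.
  have n1 : ‖c τ‖ = k := by
    rw [← sq_eq_sq₀ (norm_nonneg _) hk.le, hcτ, norm_sq_frame h]
    linear_combination (ξ ^ 2 + r ^ 2) * hκ + hr3
  have n2 : ‖c τ + ((t - s + (a' - a) * τ) • ν + ((κ * A) • e + (-(κ * B)) • f))‖ = k := by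
    rw [← sq_eq_sq₀ (norm_nonneg _) hk.le, hητ, norm_sq_frame h]
    linear_combination ((ξ + 1) ^ 2 + r ^ 2) * hκ + hr3 + hξ2
  have h4 := h2 n1 n2
  rw [add_sub_cancel_left, hητ, hcτ, householder_frame h, ← hcτ] at h4
  rw [eq_neg_iff_add_eq_zero, ← h4]
  congr 2
  module

/-- The quadratic form `b D²b(v, v) - (Db v)²` at `σ`, that is, `b²` times the Hessian of `log b`
where `b` does not vanish. -/
noncomputable def logHess (b : E3 → ℂ) (σ v : E3) : ℂ :=
  b σ * fderiv ℝ (fderiv ℝ b) σ v v - fderiv ℝ b σ v ^ 2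

theorem logHess_smul (b : E3 → ℂ) (σ v : E3) (a : ℝ) :
    logHess b σ (a • v) = (a : ℂ) ^ 2 * logHess b σ v := by
  simp only [logHess, map_smul, smul_apply, Complex.real_smul]
  ring

/-- The second-order equation satisfied by `b` alone. Since `b(σ(s, t))` has the form
`-G(t + s) / G(t - s)`, its logarithm solves the wave equation in `(s, t)`; the three terms are the
Hessian of `log b` on `∂ₛσ` and on `∂ₜσ`, and the gradient on `∂ₛ²σ - ∂ₜ²σ`. No differentiability of
`g` is needed. -/
theorem wave_identity {ν e f : E3} (h : Orthonormal ℝ ![ν, e, f]) {b g : E3 → ℂ}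
    {k ρ κ D s t A B : ℝ} (hk : 0 < k) (hD : 0 < D) (hB : 0 < B)
    (hκ : κ ^ 2 * (A ^ 2 + B ^ 2) = D)
    (hA : xiFun D s t = A) (hr : radFun k D s t = B ^ 2)
    (hσ : s • ν + ρ • e = surf ν ((κ * A) • e + (-(κ * B)) • f)
      ((κ * B) • e + (κ * A) • f) k D s t)
    (hb : ContDiffAt ℝ 2 b (s • ν + ρ • e)) (hg : Continuous g)
    (hne : g ((t - s) • ν + ((κ * A) • e + (-(κ * B)) • f)) ≠ 0)
    (heq : ReflectionEqNear k ν b g (s • ν + ρ • e)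
      (t • ν + (ρ + κ * A) • e + (-(κ * B)) • f)) :
    logHess b (s • ν + ρ • e) (ν + (s / D) • ((κ * A) • e + (-(κ * B)) • f)
        + (-(s / D * (1 + A)) / B) • ((κ * B) • e + (κ * A) • f))
      - logHess b (s • ν + ρ • e) ((-(t / D)) • ((κ * A) • e + (-(κ * B)) • f)
        + ((A * t / D) / B) • ((κ * B) • e + (κ * A) • f))
      + b (s • ν + ρ • e) * fderiv ℝ b (s • ν + ρ • e)
        ((2 / D) • ((κ * A) • e + (-(κ * B)) • f)
        + ((-(1 + 2 * A) / D + (t ^ 2 - s ^ 2) / D ^ 2 - (s / D * (1 + A) / B) ^ 2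
          + (A * t / D / B) ^ 2) / B) • ((κ * B) • e + (κ * A) • f)) = 0 := by
  have e1 := surf_line_eq h hk hD hB hκ hA hr hσ heq 1 0
  have e2 := surf_line_eq h hk hD hB hκ hA hr hσ heq 0 1
  set d := (κ * A) • e + (-(κ * B)) • f
  set d' := (κ * B) • e + (κ * A) • f
  obtain ⟨c, hc, hc0, hc2⟩ := hasDerivAt_surf_line (ν := ν) (d := d) (d' := d') hD hB hA hr 1 0
  obtain ⟨m, hm, hm0, hm2⟩ := hasDerivAt_surf_line (ν := ν) (d := d) (d' := d') hD hB hA hr 0 1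
  obtain ⟨F1, F2⟩ := hasDerivAt_comp_curve (b := b) (by simpa [← hσ] using hb) hc hc2
  obtain ⟨G1, G2⟩ := hasDerivAt_comp_curve (b := b) (by simpa [← hσ] using hb) hm hm2
  have hneg : Tendsto (fun τ : ℝ => -τ) (𝓝 0) (𝓝 0) := by
    simpa using (continuous_neg (G := ℝ)).tendsto 0
  have hcont : Continuous fun p : ℝ => g (p • ν + d) := by fun_prop
  have hn1 : ∀ᶠ τ in 𝓝 (0 : ℝ), g ((t - s + (1 - 0) * τ) • ν + d) ≠ 0 := by
    have : ContinuousAt (fun τ : ℝ => g ((t - s + (1 - 0) * τ) • ν + d)) 0 := by fun_prop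
    exact this.eventually_ne (by simpa using hne)
  have key := mul_second_deriv_sub_sq_deriv_eq F1 F2 G1 G2 (by
    filter_upwards [e1, e2, hneg.eventually e1, hneg.eventually e2, hn1, hneg.eventually hn1]
      with τ a1 a2 a3 a4 n1 n2
    -- The values at `(s ± τ, t)` and at `(s, t ± τ)` multiply to the same quotient of values of `G`,
    -- because both pairs give the same two sums `t + s ± τ` and the same two differences.
    refine mul_right_cancel₀ (mul_ne_zero n1 n2) ?_
    have q1 : t - s + (0 - 1) * τ = t - s + (1 - 0) * -τ := by ring
    have q2 : t - s + (0 - 1) * -τ = t - s + (1 - 0) * τ := by ring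
    rw [q1] at a1
    rw [q2] at a3
    simp only [zero_add, add_zero] at a1 a2 a3 a4 ⊢
    have m1 := congrArg₂ (· * ·) a1 a3
    have m2 := congrArg₂ (· * ·) a2 a4
    beta_reduce at m1 m2
    linear_combination m1 - m2)
  simp only [mul_zero, add_zero, ← hσ] at key
  rw [hc0, hm0] at key
  rw [← sub_eq_zero] at key
  simp only [logHess]
  rw [← key]
  have v1 : (1 : ℝ) • ν + ((1 * s - 0 * t) / D) • d
        + ((-1 * s / D - A * ((1 * s - 0 * t) / D)) / B) • d' =
        ν + (s / D) • d + (-(s / D * (1 + A)) / B) • d' := by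
    congr 2
    · simp
    · simp
    · ring
  have v2 : (0 : ℝ) • ν + ((0 * s - 1 * t) / D) • d
        + ((-0 * s / D - A * ((0 * s - 1 * t) / D)) / B) • d' =
        (-(t / D)) • d + ((A * t / D) / B) • d' := by
    rw [zero_smul, zero_add]
    congr 2
    · ring
    · ring
  rw [v1, v2]
  have v3 : ((2 / D) • d
        + ((-(1 + 2 * A) / D + (t ^ 2 - s ^ 2) / D ^ 2 - (s / D * (1 + A) / B) ^ 2
          + (A * t / D / B) ^ 2) / B) • d') =
          (((1 ^ 2 - 0 ^ 2) / D) • d +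
        ((-1 ^ 2 / D - ((1 * s - 0 * t) / D) ^ 2 - A * ((1 ^ 2 - 0 ^ 2) / D)
          - ((-1 * s / D - A * ((1 * s - 0 * t) / D)) / B) ^ 2) / B) • d') -
          (((0 ^ 2 - 1 ^ 2) / D) • d +
        ((-0 ^ 2 / D - ((0 * s - 1 * t) / D) ^ 2 - A * ((0 ^ 2 - 1 ^ 2) / D)
          - ((-0 * s / D - A * ((0 * s - 1 * t) / D)) / B) ^ 2) / B) • d') := by
    module
  rw [v3, map_sub]
  ring

/-! ### Analytic continuation to the pole -/

/-- The left-hand side of `wave_identity` at `σ = s ν + ρ e`, multiplied by `B³`. The variable `t`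
enters it only through `t²`, which is a function of `s`, `A` and `B`; after eliminating `t²` the
expression is a polynomial in `A` and `B`. -/
noncomputable def clearedWave (b : E3 → ℂ) (ν e f : E3) (s ρ A B : ℝ) : ℂ :=
  (B : ℂ) * logHess b (s • ν + ρ • e)
      (B • ν + (-(s / ρ * B)) • e + (-(s / ρ * (A ^ 2 + B ^ 2 + A))) • f)
    - ((B * ((s ^ 2 * (A ^ 2 + B ^ 2) ^ 2 - (2 * A + 1) * ρ ^ 2 * (A ^ 2 + B ^ 2)) / ρ ^ 2) : ℝ) : ℂ)
      * logHess b (s • ν + ρ • e) f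
    + b (s • ν + ρ • e) * fderiv ℝ b (s • ν + ρ • e)
      ((2 * B ^ 3 * A / ρ -
          (1 + 2 * A) * (2 * B ^ 2 + A ^ 2 + s ^ 2 / ρ ^ 2 * (A ^ 2 + B ^ 2)) * B / ρ) • e +
        (-(2 * B ^ 4 / ρ) -
          (1 + 2 * A) * (2 * B ^ 2 + A ^ 2 + s ^ 2 / ρ ^ 2 * (A ^ 2 + B ^ 2)) * A / ρ) • f)

theorem clearedWave_eq_zero {ν e f : E3} (h : Orthonormal ℝ ![ν, e, f]) {b g : E3 → ℂ}
    {k ρ κ s t A B : ℝ} (hk : 0 < k) (hρ : 0 < ρ) (hB : 0 < B)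
    (hκ : κ * (A ^ 2 + B ^ 2) = ρ) (hk2 : k ^ 2 = s ^ 2 + ρ ^ 2)
    (ht : t ^ 2 = s ^ 2 - (2 * A + 1) * (ρ * κ))
    (hb : ContDiffAt ℝ 2 b (s • ν + ρ • e)) (hg : Continuous g)
    (hne : g ((t • ν + (ρ + κ * A) • e + (-(κ * B)) • f) - (s • ν + ρ • e)) ≠ 0)
    (heq : ReflectionEqNear k ν b g (s • ν + ρ • e)
      (t • ν + (ρ + κ * A) • e + (-(κ * B)) • f)) :
    clearedWave b ν e f s ρ A B = 0 := by
  have hm : 0 < A ^ 2 + B ^ 2 := by positivity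
  have hκ0 : 0 < κ := by
    by_contra hcon
    nlinarith
  have hD : 0 < ρ * κ := by positivity
  have hA : xiFun (ρ * κ) s t = A := by
    rw [xiFun, ht, div_eq_iff (by positivity)]; ring
  have hr : radFun k (ρ * κ) s t = B ^ 2 := by
    rw [radFun, hA, hk2, sub_eq_iff_eq_add, div_eq_iff (by positivity)]
    linear_combination (-ρ) * hκ
  have hσ : s • ν + ρ • e = surf ν ((κ * A) • e + (-(κ * B)) • f)
      ((κ * B) • e + (κ * A) • f) k (ρ * κ) s t := by
    rw [surf, hA, hr, Real.sqrt_sq hB.le, ← hκ]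
    module
  have key := wave_identity (κ := κ) (D := ρ * κ) h hk hD hB (by rw [← hκ]; ring) hA hr hσ hb hg
    (by convert hne using 2; module) heq
  have w1 : B • (ν + (s / (ρ * κ)) • ((κ * A) • e + (-(κ * B)) • f)
        + (-(s / (ρ * κ) * (1 + A)) / B) • ((κ * B) • e + (κ * A) • f)) =
        B • ν + (-(s / ρ * B)) • e + (-(s / ρ * (A ^ 2 + B ^ 2 + A))) • f := by
    match_scalars <;> (field_simp; try ring)
  have w2 : B • ((-(t / (ρ * κ))) • ((κ * A) • e + (-(κ * B)) • f)
        + ((A * t / (ρ * κ)) / B) • ((κ * B) • e + (κ * A) • f)) =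
        (t * (A ^ 2 + B ^ 2) / ρ) • f := by
    match_scalars <;> (field_simp; try ring)
  have w3 : B ^ 3 • ((2 / (ρ * κ)) • ((κ * A) • e + (-(κ * B)) • f)
        + ((-(1 + 2 * A) / (ρ * κ) + (t ^ 2 - s ^ 2) / (ρ * κ) ^ 2
          - (s / (ρ * κ) * (1 + A) / B) ^ 2
          + (A * t / (ρ * κ) / B) ^ 2) / B) • ((κ * B) • e + (κ * A) • f)) =
      ((2 * B ^ 3 * A / ρ -
          (1 + 2 * A) * (2 * B ^ 2 + A ^ 2 + s ^ 2 / ρ ^ 2 * (A ^ 2 + B ^ 2)) * B / ρ) • e +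
        (-(2 * B ^ 4 / ρ) -
          (1 + 2 * A) * (2 * B ^ 2 + A ^ 2 + s ^ 2 / ρ ^ 2 * (A ^ 2 + B ^ 2)) * A / ρ) • f) := by
    -- The relation between `t²` and `s²` removes `t` from the coefficient of `d'`.
    have hcoef : B ^ 2 * (-(1 + 2 * A) / (ρ * κ) + (t ^ 2 - s ^ 2) / (ρ * κ) ^ 2
          - (s / (ρ * κ) * (1 + A) / B) ^ 2 + (A * t / (ρ * κ) / B) ^ 2) * κ =
        -((1 + 2 * A) * (2 * B ^ 2 + A ^ 2 + s ^ 2 / ρ ^ 2 * (A ^ 2 + B ^ 2)) / ρ) := by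
      have hκ' : κ = ρ / (A ^ 2 + B ^ 2) := by rw [eq_div_iff hm.ne', hκ]
      have ht' : (A * t / (ρ * κ) / B) ^ 2 = A ^ 2 * t ^ 2 / (ρ * κ) ^ 2 / B ^ 2 := by
        rw [div_pow, div_pow, mul_pow]
      rw [ht', ht, hκ']
      field_simp
      ring
    generalize -(1 + 2 * A) / (ρ * κ) + (t ^ 2 - s ^ 2) / (ρ * κ) ^ 2
          - (s / (ρ * κ) * (1 + A) / B) ^ 2 + (A * t / (ρ * κ) / B) ^ 2 = C at hcoef ⊢
    have c1 : B ^ 3 * (2 / (ρ * κ) * (κ * A) + C / B * (κ * B)) = 2 * B ^ 3 * A / ρ -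
        (1 + 2 * A) * (2 * B ^ 2 + A ^ 2 + s ^ 2 / ρ ^ 2 * (A ^ 2 + B ^ 2)) * B / ρ := by
      have e1 : B ^ 3 * (2 / (ρ * κ) * (κ * A) + C / B * (κ * B)) =
        2 * B ^ 3 * A / ρ + B ^ 2 * C * κ * B := by field_simp
      rw [e1, hcoef]
      ring
    have c2 : B ^ 3 * (2 / (ρ * κ) * (-(κ * B)) + C / B * (κ * A)) = -(2 * B ^ 4 / ρ) -
        (1 + 2 * A) * (2 * B ^ 2 + A ^ 2 + s ^ 2 / ρ ^ 2 * (A ^ 2 + B ^ 2)) * A / ρ := by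
      have e1 : B ^ 3 * (2 / (ρ * κ) * (-(κ * B)) + C / B * (κ * A)) =
        -(2 * B ^ 4 / ρ) + B ^ 2 * C * κ * A := by field_simp
      rw [e1, hcoef]
      ring
    rw [← c1, ← c2]
    module
  have hsq : ((t * (A ^ 2 + B ^ 2) / ρ : ℝ) : ℂ) ^ 2 =
      (((s ^ 2 * (A ^ 2 + B ^ 2) ^ 2 - (2 * A + 1) * ρ ^ 2 * (A ^ 2 + B ^ 2)) / ρ ^ 2 : ℝ) : ℂ) := by
    rw [← Complex.ofReal_pow]
    congr 1
    rw [div_pow, mul_pow, ht]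
    congr 1
    linear_combination (-(2 * A + 1) * ρ * (A ^ 2 + B ^ 2)) * hκ
  rw [clearedWave, ← w1, ← w3, logHess_smul, map_smul, Complex.ofReal_mul, ← hsq, mul_assoc (B : ℂ),
    ← logHess_smul b _ f, ← w2, logHess_smul, Complex.real_smul]
  push_cast
  linear_combination (B : ℂ) ^ 3 * key

theorem analyticAt_logHess_curve (b : E3 → ℂ) (σ : E3) {v : ℝ → E3} {θ : ℝ}
    (hv : AnalyticAt ℝ v θ) : AnalyticAt ℝ (fun θ => logHess b σ (v θ)) θ := by
  unfold logHess
  have h1 : AnalyticAt ℝ (fun θ => fderiv ℝ b σ (v θ)) θ :=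
    ((fderiv ℝ b σ).analyticAt _).comp hv
  have h2 : AnalyticAt ℝ (fun θ => fderiv ℝ (fderiv ℝ b) σ (v θ) (v θ)) θ :=
    AnalyticAt.comp₂ (h := fun p : E3 × E3 => fderiv ℝ (fderiv ℝ b) σ p.1 p.2)
      ((fderiv ℝ (fderiv ℝ b) σ).analyticAt_bilinear (v θ, v θ)) hv hv
  exact (analyticAt_const.mul h2).sub (h1.pow 2)

theorem analyticAt_clearedWave (b : E3 → ℂ) (ν e f : E3) (s ρ : ℝ) {A B : ℝ → ℝ} {θ : ℝ}
    (hA : AnalyticAt ℝ A θ) (hB : AnalyticAt ℝ B θ) :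
    AnalyticAt ℝ (fun θ => clearedWave b ν e f s ρ (A θ) (B θ)) θ := by
  have hof : ∀ {c : ℝ → ℝ}, AnalyticAt ℝ c θ → AnalyticAt ℝ (fun θ => ((c θ : ℝ) : ℂ)) θ :=
    fun hc => (Complex.ofRealCLM.analyticAt _).comp hc
  unfold clearedWave
  refine (((hof hB).mul (analyticAt_logHess_curve b _ ?_)).sub ((hof ?_).mul analyticAt_const)).add
    (analyticAt_const.mul (((fderiv ℝ b _).analyticAt _).comp ?_))
  · fun_prop
  · simp only [div_eq_mul_inv]; fun_prop
  · simp only [div_eq_mul_inv]; fun_prop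

/-- At `B = 0`, where the coordinates `(s, t)` degenerate, the Hessian terms drop out. -/
theorem clearedWave_neg_one_zero (b : E3 → ℂ) (ν e f : E3) (s ρ : ℝ) :
    clearedWave b ν e f s ρ (-1) 0 =
      b (s • ν + ρ • e) * (((-(1 + s ^ 2 / ρ ^ 2) / ρ : ℝ) : ℂ) * fderiv ℝ b (s • ν + ρ • e) f) := by
  rw [← Complex.real_smul, ← map_smul, clearedWave]
  simp only [Complex.ofReal_zero, zero_mul, sub_zero, zero_add]
  congr 2
  match_scalars <;> ring

/-- At a point `σ = s ν + ρ e` the derivative of `b` in the direction `f ⊥ ν, σ` vanishes, provided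
that the reflection equation holds near some pair `(σ, η)` with `g(η - σ) ≠ 0` and `⟨η, f⟩ < 0`.

The point `η` moves on the great circle `θ ↦ k (cos θ ν + sin θ (u e + w f))` through `ν`. The
polynomial `clearedWave` is real analytic along it and vanishes for `θ` near the initial value,
hence also at `θ = 0`, where `η = k ν`, `A = -1`, `B = 0`, and only the derivative along `f` is left,
with a nonzero factor. -/
theorem fderiv_eq_zero_of_reflectionEq {ν e f : E3} (h : Orthonormal ℝ ![ν, e, f]) {b g : E3 → ℂ}
    {k ρ s t y z : ℝ} (hk : 0 < k) (hρ : 0 < ρ) (hk2 : k ^ 2 = s ^ 2 + ρ ^ 2)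
    (hη : k ^ 2 = t ^ 2 + y ^ 2 + z ^ 2) (hz : z < 0)
    (hb : ContDiffAt ℝ 2 b (s • ν + ρ • e)) (hb0 : b (s • ν + ρ • e) ≠ 0) (hg : Continuous g)
    (hne : g ((t • ν + y • e + z • f) - (s • ν + ρ • e)) ≠ 0)
    (heq : ReflectionEqNear k ν b g (s • ν + ρ • e) (t • ν + y • e + z • f)) :
    fderiv ℝ b (s • ν + ρ • e) f = 0 := by
  obtain ⟨θ₀, u, w, hu, hw, rfl, rfl, rfl, hsin⟩ : ∃ θ₀ u w : ℝ, u ^ 2 + w ^ 2 = 1 ∧ w < 0 ∧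
      t = k * Real.cos θ₀ ∧ y = k * Real.sin θ₀ * u ∧ z = k * Real.sin θ₀ * w ∧
      0 < Real.sin θ₀ := by
    have hl : 0 < y ^ 2 + z ^ 2 := by nlinarith [sq_nonneg y, mul_pos_of_neg_of_neg hz hz]
    set l := √(y ^ 2 + z ^ 2) with hldef
    have hl0 : 0 < l := Real.sqrt_pos.2 hl
    have hl2 : l ^ 2 = y ^ 2 + z ^ 2 := Real.sq_sqrt hl.le
    have hnorm : ‖(⟨t, l⟩ : ℂ)‖ = k := by
      rw [← sq_eq_sq₀ (norm_nonneg _) hk.le, Complex.sq_norm, Complex.normSq_mk]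
      linarith
    have hc := Complex.norm_mul_cos_arg ⟨t, l⟩
    have hs := Complex.norm_mul_sin_arg ⟨t, l⟩
    rw [hnorm] at hc hs
    simp only at hc hs
    refine ⟨Complex.arg ⟨t, l⟩, y / l, z / l, ?_, div_neg_of_neg_of_pos hz hl0, hc.symm, ?_, ?_, ?_⟩
    · rw [div_pow, div_pow, ← add_div, ← hl2, div_self (by positivity)]
    · rw [hs]; field_simp
    · rw [hs]; field_simp
    · by_contra hcon
      have := mul_nonpos_of_nonneg_of_nonpos hk.le (not_lt.1 hcon)
      linarith
  set d₁ : ℝ → ℝ := fun θ => k * Real.sin θ * u - ρ with hd₁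
  set d₂ : ℝ → ℝ := fun θ => k * Real.sin θ * w with hd₂
  set D : ℝ → ℝ := fun θ => d₁ θ ^ 2 + d₂ θ ^ 2 with hD
  -- The vector `d = η^⊥ - σ^⊥` never vanishes on the circle, as `w ≠ 0` and `ρ ≠ 0`.
  have hD0 : ∀ θ, 0 < D θ := by
    intro θ
    have h1 : D θ ≠ 0 := by
      intro h0
      have h2 : d₂ θ = 0 := by simp only [hD] at h0; nlinarith [sq_nonneg (d₁ θ), sq_nonneg (d₂ θ)]
      have h3 : d₁ θ = 0 := by simp only [hD] at h0; nlinarith [sq_nonneg (d₁ θ), sq_nonneg (d₂ θ)]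
      simp only [hd₂, mul_eq_zero, hw.ne, or_false] at h2
      simp only [hd₁] at h3
      rcases h2 with h2 | h2
      · exact hk.ne' h2
      · rw [h2] at h3; linarith
    exact lt_of_le_of_ne (by positivity) h1.symm
  -- `A` and `B` are obtained from `d` by inversion: `d = κ (A e - B f)` with `κ = D / ρ`.
  set A : ℝ → ℝ := fun θ => ρ * d₁ θ / D θ with hA
  set B : ℝ → ℝ := fun θ => -(ρ * d₂ θ) / D θ with hB
  have hsin' : ∀ θ, AnalyticAt ℝ Real.sin θ := fun θ => Real.analyticAt_sin
  have hd₁a : ∀ θ, AnalyticAt ℝ d₁ θ := fun θ =>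
    ((analyticAt_const.mul (hsin' θ)).mul analyticAt_const).sub analyticAt_const
  have hd₂a : ∀ θ, AnalyticAt ℝ d₂ θ := fun θ =>
    (analyticAt_const.mul (hsin' θ)).mul analyticAt_const
  have hDa : ∀ θ, AnalyticAt ℝ D θ := fun θ => ((hd₁a θ).pow 2).add ((hd₂a θ).pow 2)
  have hEa : AnalyticOnNhd ℝ (fun θ => clearedWave b ν e f s ρ (A θ) (B θ)) Set.univ := fun θ _ =>
    analyticAt_clearedWave b ν e f s ρ ((analyticAt_const.mul (hd₁a θ)).div (hDa θ) (hD0 θ).ne')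
      ((analyticAt_const.mul (hd₂a θ)).neg.div (hDa θ) (hD0 θ).ne')
  have hpath : ContinuousAt (fun θ => (k * Real.cos θ) • ν + (k * Real.sin θ * u) • e +
      (k * Real.sin θ * w) • f) θ₀ := by fun_prop
  have hev : (fun θ => clearedWave b ν e f s ρ (A θ) (B θ)) =ᶠ[𝓝 θ₀] 0 := by
    have h1 : ∀ᶠ θ in 𝓝 θ₀, ReflectionEqNear k ν b g (s • ν + ρ • e)
        ((k * Real.cos θ) • ν + (k * Real.sin θ * u) • e + (k * Real.sin θ * w) • f) :=
      (ContinuousAt.prodMk continuousAt_const hpath).eventually heq.eventually_nhds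
    have h2 : ∀ᶠ θ in 𝓝 θ₀, g (((k * Real.cos θ) • ν + (k * Real.sin θ * u) • e +
        (k * Real.sin θ * w) • f) - (s • ν + ρ • e)) ≠ 0 :=
      (hg.continuousAt.comp (hpath.sub continuousAt_const)).eventually_ne hne
    have h3 : ∀ᶠ θ in 𝓝 θ₀, 0 < Real.sin θ :=
      Real.continuous_sin.continuousAt.eventually_const_lt hsin
    filter_upwards [h1, h2, h3] with θ h1 h2 h3
    have hd : d₂ θ < 0 := mul_neg_of_pos_of_neg (mul_pos hk h3) hw
    have hDθ := hD0 θ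
    have hAB : A θ ^ 2 + B θ ^ 2 = ρ ^ 2 / D θ := by
      simp only [hA, hB]
      rw [div_pow, div_pow, ← add_div, div_eq_div_iff (by positivity) (by positivity)]
      simp only [hD]
      ring
    have y1 : ρ + D θ / ρ * A θ = k * Real.sin θ * u := by
      simp only [hA]; field_simp; simp only [hd₁]; ring
    have z1 : -(D θ / ρ * B θ) = k * Real.sin θ * w := by
      simp only [hB]; field_simp; simp only [hd₂]
    rw [← y1, ← z1] at h1 h2
    refine clearedWave_eq_zero (κ := D θ / ρ) h hk hρ
      (div_pos (neg_pos.2 (mul_neg_of_pos_of_neg hρ hd)) hDθ) ?_ hk2 ?_ hb hg h2 h1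
    · rw [hAB]; field_simp
    · have hAD : A θ * D θ = ρ * d₁ θ := div_mul_cancel₀ _ hDθ.ne'
      have hρκ : ρ * (D θ / ρ) = D θ := by field_simp
      rw [hρκ]
      have : (k * Real.cos θ) ^ 2 = k ^ 2 - k ^ 2 * Real.sin θ ^ 2 := by
        rw [mul_pow, Real.cos_sq']; ring
      rw [this]
      have hD' : D θ = d₁ θ ^ 2 + d₂ θ ^ 2 := rfl
      have hsu : (k * Real.sin θ) ^ 2 = (d₁ θ + ρ) ^ 2 + d₂ θ ^ 2 := by
        simp only [hd₁, hd₂]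
        linear_combination (-(k * Real.sin θ) ^ 2) * hu
      linear_combination hk2 - hsu + 2 * hAD - hD'
  have h0 := hEa.eqOn_zero_of_preconnected_of_eventuallyEq_zero isPreconnected_univ
    (Set.mem_univ θ₀) hev (Set.mem_univ 0)
  have hA0 : A 0 = -1 := by simp [hA, hD, hd₁, hd₂]; field_simp
  have hB0 : B 0 = 0 := by simp [hB, hd₂]
  simp only [hA0, hB0, Pi.zero_apply, clearedWave_neg_one_zero] at h0
  have hc : ((-(1 + s ^ 2 / ρ ^ 2) / ρ : ℝ) : ℂ) ≠ 0 := by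
    rw [Complex.ofReal_ne_zero]
    have : 0 < (1 + s ^ 2 / ρ ^ 2) / ρ := by positivity
    rw [neg_div]
    exact (neg_neg_of_pos this).ne
  exact ((mul_eq_zero.1 ((mul_eq_zero.1 h0).resolve_left hb0)).resolve_left hc)

/-! ### Frames, hemispheres and gradients -/

theorem frame_expansion {ν e f : E3} (h : Orthonormal ℝ ![ν, e, f]) (v : E3) :
    v = inner ℝ v ν • ν + inner ℝ v e • e + inner ℝ v f • f := by
  have hspan : ⊤ ≤ Submodule.span ℝ (Set.range ![ν, e, f]) :=
    (h.linearIndependent.span_eq_top_of_card_eq_finrank (by simp)).ge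
  have := ((OrthonormalBasis.mk h hspan).sum_repr' v).symm
  simpa [Fin.sum_univ_three, real_inner_comm] using this

theorem exists_frame {ν σ : E3} (hν : ‖ν‖ = 1) (hσ : σ ≠ inner ℝ σ ν • ν) :
    ∃ (e f : E3) (ρ : ℝ), 0 < ρ ∧ Orthonormal ℝ ![ν, e, f] ∧ σ = inner ℝ σ ν • ν + ρ • e := by
  set x := σ - inner ℝ σ ν • ν with hx
  have hx0 : x ≠ 0 := sub_ne_zero.2 hσ
  have hρ : 0 < ‖x‖ := norm_pos_iff.2 hx0
  have hνx : inner ℝ ν (‖x‖⁻¹ • x) = 0 := by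
    rw [inner_smul_right, hx, inner_sub_right, inner_smul_right, real_inner_self_eq_norm_sq, hν,
      real_inner_comm]
    ring
  have hnx : ‖‖x‖⁻¹ • x‖ = 1 := by
    rw [norm_smul, norm_inv, norm_norm, inv_mul_cancel₀ hρ.ne']
  have hon : Orthonormal ℝ (({0, 1} : Set (Fin 3)).domRestrict ![ν, ‖x‖⁻¹ • x, 0]) := by
    constructor
    · rintro ⟨i, rfl | rfl⟩
      · exact hν
      · exact hnx
    · rintro ⟨i, rfl | rfl⟩ ⟨j, rfl | rfl⟩ hij
      · exact absurd rfl hij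
      · exact hνx
      · exact (real_inner_comm _ _).trans hνx
      · exact absurd rfl hij
  obtain ⟨B, hB⟩ := hon.exists_orthonormalBasis_extension_of_card_eq (by simp)
  have h0 : B 0 = ν := hB 0 (by simp)
  have h1 : B 1 = ‖x‖⁻¹ • x := hB 1 (by simp)
  refine ⟨‖x‖⁻¹ • x, B 2, ‖x‖, hρ, ?_, ?_⟩
  · have hfun : ![ν, ‖x‖⁻¹ • x, B 2] = B := by
      funext i
      fin_cases i
      · exact h0.symm
      · exact h1.symm
      · rfl
    rw [hfun]
    exact B.orthonormal
  · rw [smul_inv_smul₀ hρ.ne', hx]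
    module

theorem exists_orthogonal_ne_zero {ν : E3} (hν : ν ≠ 0) : ∃ v : E3, v ≠ 0 ∧ inner ℝ ν v = 0 := by
  by_contra! hcon
  have h2 : (ℝ ∙ ν)ᗮ = ⊥ := by
    rw [Submodule.eq_bot_iff]
    intro v hv
    by_contra hv0
    exact hcon v hv0 (Submodule.mem_orthogonal_singleton_iff_inner_right.1 hv)
  have h3 := (ℝ ∙ ν).finrank_add_finrank_orthogonal
  rw [h2, finrank_span_singleton hν] at h3
  simp at h3

/-- On the sphere, the complement of a plane through the origin is dense. -/
theorem exists_near_sphere_inner_ne_zero {k : ℝ} (hk : 0 < k) {a v : E3} (ha : ‖a‖ = k)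
    (hv : v ≠ 0) {p : E3 → Prop} (hp : ∀ᶠ x in 𝓝 a, p x) :
    ∃ x, p x ∧ ‖x‖ = k ∧ inner ℝ x v ≠ 0 := by
  by_cases hav : inner ℝ a v = 0
  · have hv' : 0 < ‖v‖ := norm_pos_iff.2 hv
    set c : ℝ → E3 := fun θ => Real.cos θ • a + (Real.sin θ * (k / ‖v‖)) • v with hc
    have hcont : Continuous c := by fun_prop
    have hc0 : c 0 = a := by simp [hc]
    have h1 : ∀ᶠ θ in 𝓝[>] (0 : ℝ), p (c θ) :=
      (hcont.tendsto' 0 a hc0 |>.eventually hp).filter_mono nhdsWithin_le_nhds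
    have h2 : ∀ᶠ θ in 𝓝[>] (0 : ℝ), θ ∈ Set.Ioo 0 Real.pi := Ioo_mem_nhdsGT Real.pi_pos
    obtain ⟨θ, h1, h2⟩ := (h1.and h2).exists
    refine ⟨c θ, h1, ?_, ?_⟩
    · rw [← sq_eq_sq₀ (norm_nonneg _) hk.le, hc, norm_add_sq_real, norm_smul, norm_smul,
        inner_smul_left, inner_smul_right, hav, mul_pow, mul_pow, ha]
      simp only [Real.norm_eq_abs, sq_abs, mul_zero, add_zero]
      field_simp
      linear_combination Real.sin_sq_add_cos_sq θ
    · simp only [hc, inner_add_left, inner_smul_left, hav, real_inner_self_eq_norm_sq]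
      have := Real.sin_pos_of_mem_Ioo h2
      simp only [mul_zero, zero_add]
      have : 0 < Real.sin θ * (k / ‖v‖) * ‖v‖ ^ 2 := by positivity
      exact this.ne'
  · exact ⟨a, hp.self_of_nhds, ha, hav⟩

theorem continuous_householder (ν : E3) : Continuous (householder ν) := by
  unfold householder; fun_prop

theorem norm_householder {ν : E3} (hν : ‖ν‖ = 1) (x : E3) : ‖householder ν x‖ = ‖x‖ := by
  rw [← sq_eq_sq₀ (norm_nonneg _) (norm_nonneg _), householder, norm_sub_sq_real, norm_smul,
    inner_smul_right, hν, mul_one, Real.norm_eq_abs, sq_abs]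
  ring

theorem eventually_mem_hemisphere {k : ℝ} {v x : E3} (hx : x ∈ hemisphere k v) :
    ∀ᶠ y in 𝓝 x, ‖y‖ = k → y ∈ hemisphere k v := by
  have : ContinuousAt (fun y : E3 => (inner ℝ y v : ℝ)) x := by fun_prop
  filter_upwards [this.eventually_const_lt hx.2] with y hy hn
  exact ⟨hn, hy⟩

theorem eventually_mem_Sigma2 {k : ℝ} {ν ω σ : E3} (hν : ‖ν‖ = 1) (hσ : σ ∈ Sigma2 k ν ω) :
    ∀ᶠ x in 𝓝 σ, ‖x‖ = k → x ∈ Sigma2 k ν ω := by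
  filter_upwards [eventually_mem_hemisphere hσ.1,
    (continuous_householder ν).continuousAt.eventually (eventually_mem_hemisphere hσ.2)]
    with x h1 h2 hn
  exact ⟨h1 hn, h2 ((norm_householder hν x).trans hn)⟩

theorem Sigma2Nhd_mem_nhds {k χ : ℝ} {ν ω σ : E3} (hk : 0 < k) (hχ : 0 < χ) (hν : ‖ν‖ = 1)
    (hσ : σ ∈ Sigma2 k ν ω) : Sigma2Nhd k ν ω χ ∈ 𝓝 σ := by
  have hn : ‖σ‖ = k := hσ.1.1
  have h0 : ‖σ‖ ≠ 0 := by rw [hn]; exact hk.ne'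
  have hc : ContinuousAt (fun x : E3 => (k / ‖x‖) • x) σ := by fun_prop (disch := assumption)
  have hc' : Tendsto (fun x : E3 => (k / ‖x‖) • x) (𝓝 σ) (𝓝 σ) := by
    have h1 := hc.tendsto
    rwa [hn, div_self hk.ne', one_smul] at h1
  have hd : ContinuousAt (fun x : E3 => ‖x‖ / k) σ := by fun_prop
  have h1 : ∀ᶠ x in 𝓝 σ, ‖x‖ / k ∈ Set.Ioo (1 - χ) (1 + χ) := by
    refine hd.eventually (Ioo_mem_nhds ?_ ?_) <;> beta_reduce <;> rw [hn, div_self hk.ne'] <;> linarith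
  filter_upwards [hc'.eventually (eventually_mem_Sigma2 hν hσ), h1,
    continuousAt_id.norm.eventually_ne h0] with x h2 h3 h4
  have h4 : ‖x‖ ≠ 0 := h4
  refine ⟨(k / ‖x‖) • x, h2 ?_, ‖x‖ / k, h3, ?_⟩
  · rw [norm_smul, norm_div, norm_norm, Real.norm_of_nonneg hk.le]
    field_simp
  · rw [smul_smul]
    have : ‖x‖ / k * (k / ‖x‖) = 1 := by field_simp
    rw [this, one_smul]

theorem fderiv_apply_self_eq_zero {b : E3 → ℂ} {σ : E3} {χ : ℝ} (hχ : 0 < χ)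
    (hb : DifferentiableAt ℝ b σ)
    (hrad : ∀ t ∈ Set.Ioo (1 - χ) (1 + χ), b (t • σ) = b σ) : fderiv ℝ b σ σ = 0 := by
  have h1 : HasDerivAt (fun t : ℝ => t • σ) σ 1 := by
    simpa using (hasDerivAt_id (1 : ℝ)).smul_const σ
  have h2 : HasDerivAt (fun t : ℝ => b (t • σ)) (fderiv ℝ b σ σ) 1 := by
    have h3 : HasFDerivAt b (fderiv ℝ b σ) ((1 : ℝ) • σ) := by
      rw [one_smul]; exact hb.hasFDerivAt
    exact h3.comp_hasDerivAt 1 h1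
  have h3 : (fun t : ℝ => b (t • σ)) =ᶠ[𝓝 1] fun _ => b σ := by
    filter_upwards [Ioo_mem_nhds (by linarith : 1 - χ < 1) (by linarith : (1 : ℝ) < 1 + χ)]
      with t ht using hrad t ht
  exact h2.unique ((hasDerivAt_const _ _).congr_of_eventuallyEq h3)

/-- A gradient at `σ` that annihilates `σ` and the common normal `f` of `σ` and `ν` is a complex
multiple of `π_σ ν`. -/
theorem grad_mem_complexLine {ν e f : E3} (h : Orthonormal ℝ ![ν, e, f]) {b : E3 → ℂ} {s ρ : ℝ}
    (hρ : 0 < ρ) (h1 : fderiv ℝ b (s • ν + ρ • e) (s • ν + ρ • e) = 0)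
    (h2 : fderiv ℝ b (s • ν + ρ • e) f = 0) :
    grad b (s • ν + ρ • e) ∈ complexLine (projPerp (s • ν + ρ • e) ν) := by
  have hn := norm_sq_frame h s ρ 0
  have hi := inner_frame h 1 0 0 s ρ 0
  simp only [one_smul, zero_smul, add_zero, one_mul, zero_mul] at hn hi
  set W := fderiv ℝ b (s • ν + ρ • e) with hW
  have hk : 0 < s ^ 2 + ρ ^ 2 := by positivity
  have hproj : projPerp (s • ν + ρ • e) ν =
      (ρ ^ 2 / (s ^ 2 + ρ ^ 2)) • ν + (-(s * ρ / (s ^ 2 + ρ ^ 2))) • e := by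
    rw [projPerp, hn, hi]
    match_scalars <;> (field_simp; try ring)
  rw [map_add, map_smul, map_smul, Complex.real_smul, Complex.real_smul] at h1
  refine ⟨W ν * (((s ^ 2 + ρ ^ 2) / ρ ^ 2 : ℝ) : ℂ), fun i => ?_⟩
  have hcoord : ∀ v : E3, inner ℝ (stdVec i) v = v i := fun v => by
    simp [stdVec, EuclideanSpace.inner_single_left]
  have hexp := frame_expansion h (stdVec i)
  rw [hcoord, hcoord, hcoord] at hexp
  have hWi : W (stdVec i) = (ν i : ℂ) * W ν + (e i : ℂ) * W e := by
    rw [hexp]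
    simp only [map_add, map_smul, Complex.real_smul, h2]
    ring
  have hρ' : (ρ : ℂ) ≠ 0 := Complex.ofReal_ne_zero.2 hρ.ne'
  have hk' : (s : ℂ) ^ 2 + (ρ : ℂ) ^ 2 ≠ 0 := by exact_mod_cast hk.ne'
  have hWe : W e = -(s : ℂ) / ρ * W ν := by
    field_simp
    linear_combination h1
  rw [hproj]
  change W (stdVec i) = _
  rw [hWi, hWe]
  simp only [PiLp.add_apply, PiLp.smul_apply, smul_eq_mul]
  push_cast
  field_simp
  try ring

theorem orthonormal_neg_third {ν e f : E3} (h : Orthonormal ℝ ![ν, e, f]) :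
    Orthonormal ℝ ![ν, e, -f] := by
  have h' := orthonormal_iff_ite.1 h
  rw [orthonormal_iff_ite]
  intro i j
  have := h' i j
  fin_cases i <;> fin_cases j <;> simpa using this

end ScanDiffraction

open ScanDiffraction

theorem mainTheorem1
    (k₀ : ℝ) (hk₀ : 0 < k₀)
    (ν ω : ScanDiffraction.E3) (hν : ‖ν‖ = 1) (hω : ‖ω‖ = 1)
    (χ : ℝ) (hχ : χ ∈ Set.Ioo (0 : ℝ) 1)
    (b : ScanDiffraction.E3 → ℂ)
    (hb_ne : ∀ x ∈ ScanDiffraction.Sigma2Nhd k₀ ν ω χ, b x ≠ 0)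
    (hb_radial : ∀ σ ∈ ScanDiffraction.Sigma2 k₀ ν ω,
      ∀ t ∈ Set.Ioo (1 - χ) (1 + χ), b (t • σ) = b σ)
    (hb_smooth : ContDiffOn ℝ 2 b (ScanDiffraction.Sigma2Nhd k₀ ν ω χ))
    (hb_dense : ScanDiffraction.Sigma2 k₀ ν ω ⊆
      closure {σ | σ ∈ ScanDiffraction.Sigma2 k₀ ν ω ∧
        ScanDiffraction.grad b σ ∉
          ScanDiffraction.complexLine (ScanDiffraction.projPerp σ ν)})
    (g : ScanDiffraction.E3 → ℂ) (hg_cont : Continuous g)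
    (hg : ScanDiffraction.SolvesHomogeneous k₀ ν ω b g) :
    ∀ y ∈ ScanDiffraction.Y1 k₀ ν ω ∪ ScanDiffraction.Y2 k₀ ν ω, g y = 0 := by
  rintro y (⟨η, hη, σ, hσ, rfl⟩ | ⟨η₀, hη₀, σ₀, hσ₀, rfl⟩)
  · exact (hg η hη).1 σ hσ
  by_contra hne
  -- First `η` is moved off the line `ℝ ν`, keeping `g (η - σ₀) ≠ 0`.
  obtain ⟨v, hv, hνv⟩ := exists_orthogonal_ne_zero (norm_ne_zero_iff.1 (hν.symm ▸ one_ne_zero))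
  have hgη : ∀ᶠ η in 𝓝 η₀, g (η - σ₀) ≠ 0 := by
    have : ContinuousAt (fun η => g (η - σ₀)) η₀ := by fun_prop
    exact this.eventually_ne hne
  obtain ⟨η, ⟨hη, hne⟩, hηk, hηv⟩ := exists_near_sphere_inner_ne_zero hk₀ hη₀.1 hv
    ((eventually_mem_hemisphere hη₀).and hgη)
  replace hη := hη hηk
  have hην : ∀ a : ℝ, η ≠ a • ν := by
    rintro a rfl
    rw [inner_smul_left, hνv, mul_zero] at hηv
    exact hηv rfl
  -- Then `σ` is moved off the plane spanned by `ν` and `η`, whose normal is `n`, and after that into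
  -- the dense set.
  obtain ⟨e', n, r, hr, hn, hηe⟩ := exists_frame hν (hην _)
  have hn0 : n ≠ 0 := hn.ne_zero 2
  have hgσ : ∀ {σ}, g (η - σ) ≠ 0 → ∀ᶠ x in 𝓝 σ, g (η - x) ≠ 0 := fun {σ} h => by
    have : ContinuousAt (fun x => g (η - x)) σ := by fun_prop
    exact this.eventually_ne h
  obtain ⟨σ₁, ⟨hσ₁, hne⟩, hσ₁k, hσ₁n⟩ := exists_near_sphere_inner_ne_zero hk₀ hσ₀.1.1 hn0
    ((eventually_mem_Sigma2 hν hσ₀).and (hgσ hne))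
  have hnear : ∀ᶠ x in 𝓝 σ₁, inner ℝ x n ≠ (0 : ℝ) := by
    have : ContinuousAt (fun x : E3 => (inner ℝ x n : ℝ)) σ₁ := by fun_prop
    exact this.eventually_ne hσ₁n
  obtain ⟨σ, ⟨hσ, hgrad⟩, hne, hσn⟩ :=
    ((mem_closure_iff_frequently.1 (hb_dense (hσ₁ hσ₁k))).and_eventually
      ((hgσ hne).and hnear)).exists
  have hνn : inner ℝ ν n = (0 : ℝ) := by
    simpa using hn.2 (show (0 : Fin 3) ≠ 2 by decide)
  have he'n : inner ℝ e' n = (0 : ℝ) := by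
    simpa using hn.2 (show (1 : Fin 3) ≠ 2 by decide)
  have hηn : inner ℝ η n = (0 : ℝ) := by
    rw [hηe, inner_add_left, inner_smul_left, inner_smul_left, hνn, he'n]; simp
  obtain ⟨e, f, ρ, hρ, hef, hσe⟩ := exists_frame (σ := σ) hν (by
    intro h
    rw [h, inner_smul_left, hνn, mul_zero] at hσn
    exact hσn rfl)
  set s := inner ℝ σ ν
  have hen : inner ℝ e n ≠ (0 : ℝ) := by
    intro h
    rw [hσe, inner_add_left, inner_smul_left, inner_smul_left, hνn, h] at hσn
    simp at hσn
  -- As `σ`, `ν` and `η` are linearly independent, `η` is not orthogonal to the normal `f` of `ν, σ`.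
  have hηf : inner ℝ η f ≠ (0 : ℝ) := by
    intro h
    have h1 := frame_expansion hef η
    rw [h, zero_smul, add_zero] at h1
    have h2 := hηn
    rw [h1, inner_add_left, inner_smul_left, inner_smul_left, hνn] at h2
    simp only [mul_zero, zero_add, mul_eq_zero, hen, or_false] at h2
    have h2 : inner ℝ η e = (0 : ℝ) := h2
    rw [h2, zero_smul, add_zero] at h1
    exact hην _ h1
  obtain ⟨f, hf, hηf⟩ : ∃ f, Orthonormal ℝ ![ν, e, f] ∧ inner ℝ η f < 0 := by
    rcases lt_or_gt_of_ne hηf with h | h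
    · exact ⟨f, hef, h⟩
    · exact ⟨-f, orthonormal_neg_third hef, by rw [inner_neg_right]; linarith⟩
  have hnhd := Sigma2Nhd_mem_nhds hk₀ hχ.1 hν hσ
  have hb2 : ContDiffAt ℝ 2 b σ := hb_smooth.contDiffAt hnhd
  have heq : ReflectionEqNear k₀ ν b g σ η := by
    have h1 := (eventually_mem_Sigma2 hν hσ).prod_nhds (eventually_mem_hemisphere hη)
    filter_upwards [h1] with p hp h2 h3
    exact (hg p.2 (hp.2 h3)).2 p.1 (hp.1 h2)
  have hW := fderiv_apply_self_eq_zero hχ.1 (hb2.differentiableAt (by simp)) (hb_radial σ hσ)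
  have hb0 := hb_ne σ (mem_of_mem_nhds hnhd)
  have hηx := frame_expansion hf η
  have hσk : k₀ ^ 2 = s ^ 2 + ρ ^ 2 := by
    have := norm_sq_frame hf s ρ 0
    rw [zero_smul, add_zero, ← hσe, hσ.1.1] at this
    linarith
  have hηk2 := norm_sq_frame hf (inner ℝ η ν) (inner ℝ η e) (inner ℝ η f)
  rw [← hηx, hηk] at hηk2
  rw [hηx] at heq hne
  clear_value s
  subst hσe
  exact hgrad (grad_mem_complexLine hf hρ hW
    (fderiv_eq_zero_of_reflectionEq hf hk₀ hρ hσk hηk2 hηf hb2 hb0 hg_cont hne heq))
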